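/- Let $\Gamma=(V,E,w)$ be a finite simple digraph with vertex set $V=\{1,\dots,n\}$, edge set $E\subseteq V\times V$ (no loops), and non-negative weights $w\colon V\times V\to\mathbb{R}_{\ge 0}$, where $w_{ij}=0$ if and only if $(i,j)\notin E$. Let $L=D-A$ be its graph Laplacian, where $A=[w_{ij}]_{i,j=1}^n$ and $D$ is the diagonal matrix of the out-degrees $d^+(i)=\sum_{j\in V}w_{ij}$. A strongly connected component of $\Gamma$ is a maximal non-empty induced subgraph in which, for any two distinct vertices $i,j$, there is a directed path from $i$ to $j$ and a directed path from $j$ to $i$; a strongly connected component with vertex set $V'$ is called isolated if $w_{ij}=0$ for all $i\in V'$ and $j\in V\setminus V'$ (no edge leaves $V'$). Then, for every $k\in\mathbb{N}$ (including $k=0$), the following statements are equivalent: \begin{enumerate} \item[(i)] the algebraic multiplicity of $0$ as an eigenvalue of $L$ (its multiplicity as a root of the characteristic polynomial) is equal to $k$; \item[(ii)] there are exactly $k$ isolated strongly connected components of $\Gamma$; \item[(iii)] the geometric multiplicity of $0$ as an eigenvalue of $L$ (the dimension of the eigenspace $\ker L$) is equal to $k$. \end{enumerate} -/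

import Mathlib

open scoped NNReal

/-- A simple digraph with vertex set `V` and nonnegative edge weights: there are no loops, and
`weight i j = 0` exactly when there is no edge from `i` to `j`. -/
structure WeightedDigraph (V : Type*) extends Digraph V where
  weight : V → V → ℝ≥0
  weight_eq_zero_iff : ∀ i j, weight i j = 0 ↔ ¬ Adj i j
  loopless : ∀ i, ¬ Adj i i

namespace WeightedDigraph

/-- The out-degree of a vertex: the sum of the weights of the edges leaving it. -/
def outDegree {V : Type*} [Fintype V] (Γ : WeightedDigraph V) (i : V) : ℝ :=
  ∑ j, (Γ.weight i j : ℝ)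

/-- The weighted adjacency matrix. -/
def adjMatrix {V : Type*} (Γ : WeightedDigraph V) : Matrix V V ℝ :=
  Matrix.of fun i j => (Γ.weight i j : ℝ)

/-- The graph Laplacian: out-degree matrix minus weighted adjacency matrix. -/
noncomputable def laplacian {V : Type*} [Fintype V] [DecidableEq V] (Γ : WeightedDigraph V) :
    Matrix V V ℝ :=
  Matrix.diagonal Γ.outDegree - Γ.adjMatrix

/-- The subgraph induced on a set of vertices. -/
def induce {V : Type*} (Γ : WeightedDigraph V) (S : Set V) : WeightedDigraph S where
  Adj i j := Γ.Adj i j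
  weight i j := Γ.weight i j
  weight_eq_zero_iff i j := Γ.weight_eq_zero_iff i j
  loopless i := Γ.loopless i

/-- There is a directed path (with at least one edge) from `i` to `j`. -/
def HasPath {V : Type*} (Γ : WeightedDigraph V) (i j : V) : Prop :=
  Relation.TransGen Γ.Adj i j

/-- Any two distinct vertices are joined by directed paths in both directions. -/
def StronglyConnected {V : Type*} (Γ : WeightedDigraph V) : Prop :=
  ∀ i j, i = j ∨ (Γ.HasPath i j ∧ Γ.HasPath j i)

/-- `S` is the vertex set of a strongly connected component, that is, of a maximal (nonempty)
strongly connected induced subgraph. -/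
def IsStronglyConnectedComponent {V : Type*} (Γ : WeightedDigraph V) (S : Set V) : Prop :=
  Maximal (fun T : Set V => T.Nonempty ∧ (Γ.induce T).StronglyConnected) S

/-- The subgraph induced on `S` is isolated: no edge leaves `S` (edges into `S` are allowed). -/
def IsIsolated {V : Type*} (Γ : WeightedDigraph V) (S : Set V) : Prop :=
  ∀ i ∈ S, ∀ j ∉ S, Γ.weight i j = 0

/-- The number of isolated strongly connected components. -/
noncomputable def numIsolatedComponents {V : Type*} (Γ : WeightedDigraph V) : ℕ :=
  Set.ncard {S : Set V | Γ.IsStronglyConnectedComponent S ∧ Γ.IsIsolated S}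

end WeightedDigraph

/-- The multiplicity of `μ` as a complex root of the characteristic polynomial of a real matrix. -/
noncomputable def algebraicMultiplicity {V : Type*} [Fintype V] [DecidableEq V]
    (M : Matrix V V ℝ) (μ : ℂ) : ℕ :=
  (M.map Complex.ofReal).charpoly.rootMultiplicity μ

/-- The complex dimension of the eigenspace of a real matrix for the complex number `μ`. -/
noncomputable def geometricMultiplicity {V : Type*} [Fintype V] [DecidableEq V]
    (M : Matrix V V ℝ) (μ : ℂ) : ℕ :=
  Module.finrank ℂ (Module.End.eigenspace (Matrix.toLin' (M.map Complex.ofReal)) μ)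

namespace WeightedDigraph

variable {V : Type*}

/-! ### Reachability and isolated components -/

/-- There is a directed path, possibly of length zero, from `i` to `j`. -/
def Reachable (Γ : WeightedDigraph V) : V → V → Prop :=
  Relation.ReflTransGen Γ.Adj

/-- `S` is the vertex set of an isolated strongly connected component. -/
def IsIsolatedComponent (Γ : WeightedDigraph V) (S : Set V) : Prop :=
  Γ.IsStronglyConnectedComponent S ∧ Γ.IsIsolated S

variable {Γ : WeightedDigraph V} {S T : Set V}

theorem StronglyConnected.reachable (hS : (Γ.induce S).StronglyConnected) {i j : V}
    (hi : i ∈ S) (hj : j ∈ S) : Γ.Reachable i j := by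
  rcases hS ⟨i, hi⟩ ⟨j, hj⟩ with h | ⟨h, -⟩
  · obtain rfl : i = j := congrArg Subtype.val h
    exact Relation.ReflTransGen.refl
  · exact h.to_reflTransGen.lift (p := Γ.Adj) Subtype.val fun _ _ h => h

theorem IsIsolated.mem_of_adj (hS : Γ.IsIsolated S) {i j : V} (hi : i ∈ S) (hij : Γ.Adj i j) :
    j ∈ S := by
  by_contra hj
  exact (Γ.weight_eq_zero_iff i j).1 (hS i hi j hj) hij

theorem IsIsolated.mem_of_reachable (hS : Γ.IsIsolated S) {i j : V} (hi : i ∈ S)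
    (hij : Γ.Reachable i j) : j ∈ S := by
  induction hij with
  | refl => exact hi
  | tail _ h ih => exact hS.mem_of_adj ih h

theorem IsIsolated.reachable_induce (hS : Γ.IsIsolated S) {i j : V} (hi : i ∈ S)
    (hij : Γ.Reachable i j) :
    ∃ hj : j ∈ S, (Γ.induce S).Reachable ⟨i, hi⟩ ⟨j, hj⟩ := by
  induction hij with
  | refl => exact ⟨hi, Relation.ReflTransGen.refl⟩
  | tail _ h ih =>
    obtain ⟨hb, hab⟩ := ih
    exact ⟨hS.mem_of_adj hb h, Relation.ReflTransGen.tail hab h⟩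

theorem IsIsolatedComponent.nonempty (hS : Γ.IsIsolatedComponent S) : S.Nonempty :=
  hS.1.prop.1

theorem IsIsolatedComponent.reachable (hS : Γ.IsIsolatedComponent S) {i j : V}
    (hi : i ∈ S) (hj : j ∈ S) : Γ.Reachable i j :=
  hS.1.prop.2.reachable hi hj

theorem IsIsolatedComponent.eq_setOf_reachable (hS : Γ.IsIsolatedComponent S) {i : V}
    (hi : i ∈ S) : S = {j | Γ.Reachable i j} :=
  Set.ext fun _ => ⟨fun hj => hS.reachable hi hj, fun hj => hS.2.mem_of_reachable hi hj⟩

theorem IsIsolatedComponent.eq_of_mem (hS : Γ.IsIsolatedComponent S)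
    (hT : Γ.IsIsolatedComponent T) {i : V} (hi : i ∈ S) (hi' : i ∈ T) : S = T :=
  (hS.eq_setOf_reachable hi).trans (hT.eq_setOf_reachable hi').symm

/-- If every vertex reachable from `i` reaches `i`, then the vertices reachable from `i` form an
isolated strongly connected component. -/
theorem isIsolatedComponent_setOf_reachable {i : V}
    (hi : ∀ j, Γ.Reachable i j → Γ.Reachable j i) :
    Γ.IsIsolatedComponent {j | Γ.Reachable i j} := by
  have hiso : Γ.IsIsolated {j | Γ.Reachable i j} := fun a ha b hb =>
    (Γ.weight_eq_zero_iff a b).2 fun hab => hb (Relation.ReflTransGen.tail ha hab)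
  have hpath : ∀ a b : {j | Γ.Reachable i j}, a = b ∨ (Γ.induce _).HasPath a b := fun a b => by
    obtain ⟨_, h⟩ := hiso.reachable_induce a.2 ((hi _ a.2).trans b.2)
    rcases Relation.reflTransGen_iff_eq_or_transGen.1 h with h | h
    · exact Or.inl h.symm
    · exact Or.inr h
  refine ⟨⟨⟨⟨i, Relation.ReflTransGen.refl⟩, fun a b => ?_⟩, fun T hT hle t ht => ?_⟩, hiso⟩
  · rcases hpath a b with h | h
    · exact Or.inl h
    · rcases hpath b a with h' | h'
      · exact Or.inl h'.symm
      · exact Or.inr ⟨h, h'⟩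
  · exact hT.2.reachable (hle Relation.ReflTransGen.refl) ht

/-- In a finite digraph every vertex reaches an isolated strongly connected component. -/
theorem exists_isIsolatedComponent_reachable [Finite V] (Γ : WeightedDigraph V) (i : V) :
    ∃ S, Γ.IsIsolatedComponent S ∧ ∃ j ∈ S, Γ.Reachable i j := by
  obtain ⟨m, him, hm⟩ := Set.exists_min_image {j | Γ.Reachable i j}
    (fun j => Set.ncard {l | Γ.Reachable j l}) (Set.toFinite _) ⟨i, Relation.ReflTransGen.refl⟩
  refine ⟨_, isIsolatedComponent_setOf_reachable (i := m) fun j hmj => ?_, m,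
    Relation.ReflTransGen.refl, him⟩
  have hsub : {l | Γ.Reachable j l} ⊆ {l | Γ.Reachable m l} := fun l hl =>
    Relation.ReflTransGen.trans hmj hl
  have heq := Set.eq_of_subset_of_ncard_le hsub (hm j (Relation.ReflTransGen.trans him hmj))
    (Set.toFinite _)
  have : m ∈ {l | Γ.Reachable m l} := Relation.ReflTransGen.refl
  rwa [← heq] at this

/-! ### The maximum principle -/

variable [Fintype V]

/-- Maximum principle: if every vertex reaches `B`, a real function that is harmonic off `B` and
nonpositive on `B` is nonpositive. -/
theorem nonpos_of_harmonic {B : Set V} (hB : ∀ i, ∃ j ∈ B, Γ.Reachable i j) {u : V → ℝ}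
    (hharm : ∀ i ∉ B, ∑ j, (Γ.weight i j : ℝ) * (u i - u j) = 0) (hu : ∀ i ∈ B, u i ≤ 0)
    (i : V) : u i ≤ 0 := by
  have : Nonempty V := ⟨i⟩
  obtain ⟨m, hm⟩ := Finite.exists_max u
  have key : ∀ j, Γ.Reachable m j → u j = u m ∨ u m ≤ 0 := fun j hj => by
    induction hj with
    | refl => exact Or.inl rfl
    | @tail a b _ hab ih =>
      rcases ih with ha | h
      · by_cases haB : a ∈ B
        · exact Or.inr (ha ▸ hu a haB)
        · left
          have hnn : ∀ j ∈ Finset.univ, 0 ≤ (Γ.weight a j : ℝ) * (u a - u j) := fun j _ =>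
            mul_nonneg (Γ.weight a j).2 (by linarith [hm j])
          have h0 := (Finset.sum_eq_zero_iff_of_nonneg hnn).1 (hharm a haB) b (Finset.mem_univ b)
          rcases mul_eq_zero.1 h0 with h | h
          · exact absurd hab ((Γ.weight_eq_zero_iff a b).1 (by exact_mod_cast h))
          · linarith
      · exact Or.inr h
  obtain ⟨j, hjB, hj⟩ := hB m
  rcases key j hj with h | h
  · linarith [hm i, hu j hjB]
  · exact (hm i).trans h

theorem eq_zero_of_harmonic {B : Set V} (hB : ∀ i, ∃ j ∈ B, Γ.Reachable i j) {u : V → ℝ}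
    (hharm : ∀ i ∉ B, ∑ j, (Γ.weight i j : ℝ) * (u i - u j) = 0) (hu : ∀ i ∈ B, u i = 0)
    (i : V) : u i = 0 := by
  refine le_antisymm (nonpos_of_harmonic hB hharm (fun i hi => (hu i hi).le) i) ?_
  have := nonpos_of_harmonic hB (u := fun i => -u i) (fun i hi => ?_)
    (fun i hi => by simp [hu i hi]) i
  · linarith
  · rw [← neg_eq_zero, ← Finset.sum_neg_distrib, ← hharm i hi]
    exact Finset.sum_congr rfl fun j _ => by ring

/-! ### The Laplacian as a complex operator -/

variable [DecidableEq V]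

/-- The Laplacian acting on complex functions on the vertices. -/
noncomputable def laplacianOp (Γ : WeightedDigraph V) : Module.End ℂ (V → ℂ) :=
  Matrix.toLin' (Γ.laplacian.map Complex.ofReal)

theorem laplacianOp_apply (Γ : WeightedDigraph V) (f : V → ℂ) (i : V) :
    Γ.laplacianOp f i = ∑ j, ((Γ.weight i j : ℝ) : ℂ) * (f i - f j) := by
  have h : Γ.laplacian.map Complex.ofReal =
      Matrix.diagonal (fun i => (Γ.outDegree i : ℂ)) - Γ.adjMatrix.map Complex.ofReal := by
    ext a b
    rcases eq_or_ne a b with rfl | hab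
    · simp [laplacian]
    · simp [laplacian, hab]
  rw [laplacianOp, Matrix.toLin'_apply, h, Matrix.sub_mulVec, Pi.sub_apply,
    Matrix.mulVec_diagonal]
  simp only [Matrix.mulVec, dotProduct, Matrix.map_apply, adjMatrix, Matrix.of_apply, outDegree,
    Complex.ofReal_sum, mul_sub, Finset.sum_sub_distrib, Finset.sum_mul]

/-- For a small step `ε`, the operator `1 - ε L` is a contraction in the supremum norm. -/
theorem exists_norm_sub_smul_laplacianOp_le (Γ : WeightedDigraph V) :
    ∃ ε : ℝ, 0 < ε ∧ ∀ f : V → ℂ, ‖f - (ε : ℂ) • Γ.laplacianOp f‖ ≤ ‖f‖ := by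
  have hd : ∀ i, 0 ≤ Γ.outDegree i := fun i => Finset.sum_nonneg fun j _ => (Γ.weight i j).2
  have hs : 0 ≤ ∑ i, Γ.outDegree i := Finset.sum_nonneg fun i _ => hd i
  have hε : 0 < (1 + ∑ i, Γ.outDegree i)⁻¹ := by positivity
  refine ⟨(1 + ∑ i, Γ.outDegree i)⁻¹, hε, fun f => ?_⟩
  have hle : ∀ i, (1 + ∑ i, Γ.outDegree i)⁻¹ * Γ.outDegree i ≤ 1 := fun i => by
    rw [inv_mul_le_one₀ (by positivity)]
    have := Finset.single_le_sum (fun i _ => hd i) (Finset.mem_univ i)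
    linarith
  generalize (1 + ∑ i, Γ.outDegree i)⁻¹ = ε at hε hle
  refine (pi_norm_le_iff_of_nonneg (norm_nonneg f)).2 fun i => ?_
  have hrw : (f - (ε : ℂ) • Γ.laplacianOp f) i =
      ((1 - ε * Γ.outDegree i : ℝ) : ℂ) * f i + ∑ j, ((ε * Γ.weight i j : ℝ) : ℂ) * f j := by
    simp only [Pi.sub_apply, Pi.smul_apply, smul_eq_mul, laplacianOp_apply, outDegree, mul_sub,
      Finset.sum_sub_distrib, ← Finset.sum_mul, ← Finset.mul_sum, Complex.ofReal_sub,
      Complex.ofReal_mul, Complex.ofReal_sum, Complex.ofReal_one, mul_assoc]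
    ring
  rw [hrw]
  calc _ ≤ ‖((1 - ε * Γ.outDegree i : ℝ) : ℂ) * f i‖ +
        ∑ j, ‖((ε * Γ.weight i j : ℝ) : ℂ) * f j‖ :=
        (norm_add_le _ _).trans (by gcongr; exact norm_sum_le _ _)
    _ ≤ (1 - ε * Γ.outDegree i) * ‖f‖ + ∑ j, (ε * Γ.weight i j) * ‖f‖ := by
        gcongr with j
        · rw [norm_mul, Complex.norm_real, Real.norm_of_nonneg (by linarith [hle i])]
          exact mul_le_mul_of_nonneg_left (norm_le_pi_norm f i) (by linarith [hle i])
        · have : 0 ≤ ε * (Γ.weight i j : ℝ) := mul_nonneg hε.le (Γ.weight i j).2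
          rw [norm_mul, Complex.norm_real, Real.norm_of_nonneg this]
          exact mul_le_mul_of_nonneg_left (norm_le_pi_norm f j) this
    _ = ‖f‖ := by
        rw [← Finset.sum_mul, ← Finset.mul_sum, outDegree]
        ring

theorem laplacianOp_eq_zero_of_sq (Γ : WeightedDigraph V) {f : V → ℂ}
    (hf : Γ.laplacianOp (Γ.laplacianOp f) = 0) : Γ.laplacianOp f = 0 := by
  obtain ⟨ε, hε, hcontr⟩ := Γ.exists_norm_sub_smul_laplacianOp_le
  have hbound : ∀ m : ℕ, ‖f - ((m * ε : ℝ) : ℂ) • Γ.laplacianOp f‖ ≤ ‖f‖ := fun m => by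
    induction m with
    | zero => simp
    | succ m ih =>
      refine le_trans (le_of_eq ?_) ((hcontr _).trans ih)
      rw [map_sub, map_smul, hf, smul_zero, sub_zero, sub_sub, ← add_smul]
      push_cast
      ring_nf
  by_contra hne
  have hpos : 0 < ε * ‖Γ.laplacianOp f‖ := mul_pos hε (norm_pos_iff.2 hne)
  obtain ⟨m, hm⟩ := exists_nat_gt (2 * ‖f‖ / (ε * ‖Γ.laplacianOp f‖))
  rw [div_lt_iff₀ hpos] at hm
  have h1 : ‖((m * ε : ℝ) : ℂ) • Γ.laplacianOp f‖ ≤ 2 * ‖f‖ := by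
    have := norm_sub_le f (f - ((m * ε : ℝ) : ℂ) • Γ.laplacianOp f)
    rw [sub_sub_cancel] at this
    linarith [hbound m]
  rw [norm_smul, Complex.norm_real, Real.norm_of_nonneg (by positivity)] at h1
  linarith

theorem maxGenEigenspace_laplacianOp_zero (Γ : WeightedDigraph V) :
    Γ.laplacianOp.maxGenEigenspace 0 = Γ.laplacianOp.eigenspace 0 := by
  refine le_antisymm (fun f hf => ?_) Module.End.eigenspace_le_maxGenEigenspace
  obtain ⟨k, hk⟩ := (Module.End.mem_maxGenEigenspace _ _ _).1 hf
  rw [zero_smul, sub_zero] at hk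
  rw [Module.End.eigenspace_zero, LinearMap.mem_ker]
  induction k with
  | zero => rw [pow_zero, Module.End.one_apply] at hk; rw [hk, map_zero]
  | succ k ih =>
    rcases k with _ | k
    · simpa using hk
    · apply ih
      rw [pow_succ', pow_succ', Module.End.mul_apply, Module.End.mul_apply] at hk
      rw [pow_succ', Module.End.mul_apply]
      exact Γ.laplacianOp_eq_zero_of_sq hk

theorem algebraicMultiplicity_laplacian_zero (Γ : WeightedDigraph V) :
    algebraicMultiplicity Γ.laplacian 0 = geometricMultiplicity Γ.laplacian 0 := by
  rw [algebraicMultiplicity, geometricMultiplicity, ← Matrix.charpoly_toLin',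
    ← LinearMap.finrank_maxGenEigenspace_eq]
  exact congrArg (fun W : Submodule ℂ (V → ℂ) => Module.finrank ℂ W)
    Γ.maxGenEigenspace_laplacianOp_zero

/-! ### The Dirichlet problem -/

/-- Uniqueness in the Dirichlet problem. -/
theorem eq_zero_of_laplacianOp_eq_zero {B : Set V} (hB : ∀ i, ∃ j ∈ B, Γ.Reachable i j)
    {f : V → ℂ} (hharm : ∀ i ∉ B, Γ.laplacianOp f i = 0) (hf : ∀ i ∈ B, f i = 0) : f = 0 := by
  funext i
  refine Complex.ext ?_ ?_
  · refine eq_zero_of_harmonic hB (u := fun i => (f i).re) (fun i hi => ?_)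
      (fun i hi => by simp [hf i hi]) i
    simpa [laplacianOp_apply] using congrArg Complex.re (hharm i hi)
  · refine eq_zero_of_harmonic hB (u := fun i => (f i).im) (fun i hi => ?_)
      (fun i hi => by simp [hf i hi]) i
    simpa [laplacianOp_apply] using congrArg Complex.im (hharm i hi)

/-- Existence in the Dirichlet problem. -/
theorem exists_laplacianOp_eq_zero {B : Set V} (hB : ∀ i, ∃ j ∈ B, Γ.Reachable i j)
    (g : V → ℂ) : ∃ f : V → ℂ, (∀ i ∉ B, Γ.laplacianOp f i = 0) ∧ ∀ i ∈ B, f i = g i := by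
  classical
  let D : (V → ℂ) →ₗ[ℂ] (V → ℂ) := LinearMap.pi fun i =>
    if i ∈ B then LinearMap.proj i else LinearMap.proj i ∘ₗ Γ.laplacianOp
  have hmem : ∀ f, ∀ i ∈ B, D f i = f i := fun f i hi => by simp [D, hi]
  have hnot : ∀ f, ∀ i ∉ B, D f i = Γ.laplacianOp f i := fun f i hi => by simp [D, hi]
  have hinj : Function.Injective D := by
    refine (injective_iff_map_eq_zero D).2 fun f hf => ?_
    refine eq_zero_of_laplacianOp_eq_zero hB (fun i hi => ?_) fun i hi => ?_
    · rw [← hnot f i hi, hf, Pi.zero_apply]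
    · rw [← hmem f i hi, hf, Pi.zero_apply]
  obtain ⟨f, hf⟩ := LinearMap.injective_iff_surjective.1 hinj fun i => if i ∈ B then g i else 0
  refine ⟨f, fun i hi => ?_, fun i hi => ?_⟩
  · rw [← hnot f i hi, hf]
    exact if_neg hi
  · rw [← hmem f i hi, hf]
    exact if_pos hi

/-! ### The kernel of the Laplacian -/

theorem finrank_ker_laplacianOp (Γ : WeightedDigraph V) :
    Module.finrank ℂ (LinearMap.ker Γ.laplacianOp) = Γ.numIsolatedComponents := by
  classical
  let C := {S : Set V | Γ.IsIsolatedComponent S}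
  have : Fintype C := Fintype.ofFinite C
  choose r hr using fun S : C => IsIsolatedComponent.nonempty S.2
  let φ : LinearMap.ker Γ.laplacianOp →ₗ[ℂ] (C → ℂ) :=
    LinearMap.pi (fun S => LinearMap.proj (r S)) ∘ₗ Submodule.subtype _
  have hφ : Function.Bijective φ := by
    constructor
    · refine (injective_iff_map_eq_zero φ).2 fun f hf => Subtype.ext ?_
      refine eq_zero_of_laplacianOp_eq_zero (Γ := Γ) (B := Set.range r) (fun i => ?_)
        (fun i _ => congrFun (LinearMap.mem_ker.1 f.2) i) ?_
      · obtain ⟨S, hS, j, hj, hij⟩ := Γ.exists_isIsolatedComponent_reachable i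
        exact ⟨_, ⟨⟨S, hS⟩, rfl⟩, hij.trans (hS.reachable hj (hr ⟨S, hS⟩))⟩
      · rintro _ ⟨S, rfl⟩
        exact congrFun hf S
    · intro g
      let B : Set V := {i | ∃ S : C, i ∈ S.1}
      have hB : ∀ i, ∃ j ∈ B, Γ.Reachable i j := fun i => by
        obtain ⟨S, hS, j, hj, hij⟩ := Γ.exists_isIsolatedComponent_reachable i
        exact ⟨j, ⟨⟨S, hS⟩, hj⟩, hij⟩
      obtain ⟨f, hharm, hf⟩ := exists_laplacianOp_eq_zero hB
        fun i => if h : i ∈ B then g h.choose else 0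
      have hval : ∀ S : C, ∀ i ∈ S.1, f i = g S := fun S i hi => by
        have h : i ∈ B := ⟨S, hi⟩
        rw [hf i h, dif_pos h]
        exact congrArg g (Subtype.ext
          (IsIsolatedComponent.eq_of_mem h.choose.2 S.2 h.choose_spec hi))
      refine ⟨⟨f, LinearMap.mem_ker.2 (funext fun i => ?_)⟩, funext fun S => hval S _ (hr S)⟩
      by_cases h : i ∈ B
      · obtain ⟨S, hi⟩ := h
        rw [laplacianOp_apply]
        refine Finset.sum_eq_zero fun j _ => ?_
        by_cases hj : j ∈ S.1
        · rw [hval S i hi, hval S j hj, sub_self, mul_zero]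
        · have hw : Γ.weight i j = 0 := S.2.2 i hi j hj
          simp [hw]
      · exact hharm i h
  rw [(LinearEquiv.ofBijective φ hφ).finrank_eq, Module.finrank_fintype_fun_eq_card,
    ← Nat.card_eq_fintype_card]
  rfl

theorem geometricMultiplicity_laplacian_zero (Γ : WeightedDigraph V) :
    geometricMultiplicity Γ.laplacian 0 = Γ.numIsolatedComponents := by
  rw [geometricMultiplicity, Module.End.eigenspace_zero]
  exact Γ.finrank_ker_laplacianOp

end WeightedDigraph

theorem mainTheorem8 {V : Type*} [Fintype V] [DecidableEq V] (Γ : WeightedDigraph V) (k : ℕ) :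
    List.TFAE [
      algebraicMultiplicity Γ.laplacian 0 = k,
      Γ.numIsolatedComponents = k,
      geometricMultiplicity Γ.laplacian 0 = k] := by
  rw [Γ.algebraicMultiplicity_laplacian_zero, Γ.geometricMultiplicity_laplacian_zero]
  simp
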